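/- Let $\Omega=I\cup J\subset\mathbb{R}$, where $I,J$ are disjoint bounded intervals of positive, different lengths (endpoints may or may not belong to them), and assume that $\Omega$ weakly tiles its complement $\Omega^\complement=\mathbb{R}\setminus\Omega$, i.e. that there is a positive, locally finite Borel measure $\nu$ on $\mathbb{R}$ (a weak tiling measure) with $\mathbf 1_\Omega*\nu=\mathbf 1_{\Omega^\complement}$ almost everywhere. Then every weak tiling measure $\nu$ for $\Omega$ is a proper tiling in which short and long intervals alternate. That is, there is a countable set $T\subset\mathbb{R}$ such that $\nu=\sum_{t\in T}\delta_t$; the translates $\Omega+t$, $t\in T$, are pairwise disjoint up to null sets and their union equals $\Omega^\complement$ up to a null set; and in the family of all intervals $I+t$, $J+t$ with $t\in T\cup\{0\}$ (the intervals of the tiling together with $I$ and $J$ themselves) every translate of $I$ is immediately followed and immediately preceded by a translate of $J$, and every translate of $J$ is immediately followed and immediately preceded by a translate of $I$. (Interval $K$ immediately precedes interval $K'$ if the right endpoint of $K$ equals the left endpoint of $K'$.) -/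

import Mathlib

open MeasureTheory
open scoped ENNReal

namespace WeakTiling

/-- A bounded interval of positive length; each endpoint may or may not belong to it. -/
structure IsInterval (I : Set ℝ) : Prop where
  ordConnected : I.OrdConnected
  bounded : Bornology.IsBounded I
  nondegenerate : (interior I).Nonempty

/-- The translate `A + t`. -/
def translate (A : Set ℝ) (t : ℝ) : Set ℝ := (fun x => x + t) '' A

/-- The convolution `1_A * ν`, that is `x ↦ ∫ 1_A(x - t) dν(t)`. -/
noncomputable def indicatorConv (A : Set ℝ) (ν : Measure ℝ) (x : ℝ) : ℝ≥0∞ :=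
  ∫⁻ t, A.indicator (fun _ => (1 : ℝ≥0∞)) (x - t) ∂ν

/-- `ν` is a weak tiling measure for `A`: a positive, locally finite (Borel) measure with
`1_A * ν = 1_{Aᶜ}` almost everywhere. -/
structure IsWeakTilingMeasure (A : Set ℝ) (ν : Measure ℝ) : Prop where
  locallyFinite : IsLocallyFiniteMeasure ν
  conv_eq : ∀ᵐ x ∂(volume : Measure ℝ),
    indicatorConv A ν x = Aᶜ.indicator (fun _ => (1 : ℝ≥0∞)) x

/-- The translates `A + t`, `t ∈ T`, tile `B` properly, up to null sets. -/
structure IsProperTiling (A T B : Set ℝ) : Prop where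
  countable : T.Countable
  disjoint : T.Pairwise fun s t => AEDisjoint volume (translate A s) (translate A t)
  cover : (⋃ t ∈ T, translate A t) =ᵐ[volume] B

/-- In the family of all intervals `I + t` and `J + t`, `t ∈ T`, each translate of `I` is
immediately followed and immediately preceded by a translate of `J`, and vice versa.
The right endpoint of `I + t` is `sSup I + t`, the left one is `sInf I + t`. -/
def Alternating (I J T : Set ℝ) : Prop :=
  ∀ t ∈ T,
    (∃ s ∈ T, sSup I + t = sInf J + s) ∧ (∃ s ∈ T, sSup J + s = sInf I + t) ∧
    (∃ s ∈ T, sSup J + t = sInf I + s) ∧ (∃ s ∈ T, sSup I + s = sInf J + t)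

end WeakTiling

/-!
Let the short interval of `Ω` be `[i, i + a)` and the long one `[j, j + b)`, `a < b`, up to
endpoints, and let `μ = ν + δ₀`, so that `1_Ω * μ = 1` almost everywhere. Taking one-sided limits
gives this identity at *every* point for both half-open versions of `Ω` (`TilesLine`). Comparing
the two versions shows that at each point as much mass of intervals starts as ends
(`TilesLine.endpoint_balance`), while a point `t` with `μ {t} = 1` blocks all mass whose tiles would
overlap the tile at `t` (`TilesLine.exists_nhds_null`).

A short interval of full mass cannot be adjacent to another short interval, since the long interval
of the latter tile would overlap that of the former. By endpoint balance it is then followed and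
preceded by long intervals of full mass: with `p = i + a - j` and `d = a + b`, `μ {t} = 1` implies
`μ {t + p} = μ {t + p - d} = 1`. Starting from `t = 0`, all `N p - m d` with `0 ≤ m ≤ N` have mass
one, so every multiple of `d` is a difference of two such points. No difference of two such points
lies in the open interval `(p - d, p)` of length `d`, whence `p = k d` for an integer `k`
(`TilesLine.exists_offset_eq_int_mul`).

So the set of `n` with `μ {n d} = 1` contains `0` and is closed under adding `k` and `k - 1`, two
consecutive integers of the same weak sign; it contains all integers far out on one side. Endpoint
balance, read as a recurrence, extends this to all integers
(`TilesLine.singleton_int_mul_eq_one`). These tiles leave no room for mass off the lattice `ℤ d`,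
so `ν` is the sum of the Dirac masses at the nonzero points of `ℤ d`. Tiling and alternation can
then be read off, the neighbours of a short interval being the long intervals of the tiles shifted
by `k d` and `(k - 1) d`.
-/

open Set Filter Topology

namespace WeakTiling

/-! ### From almost every point to every point -/

lemma indicatorConv_eq_measure {A : Set ℝ} (hA : MeasurableSet A) (ν : Measure ℝ) (x : ℝ) :
    indicatorConv A ν x = ν {t | x - t ∈ A} := by
  have hm : MeasurableSet {t : ℝ | x - t ∈ A} := (measurable_const.sub measurable_id) hA
  rw [← lintegral_indicator_one hm]
  rfl

/-- If `1_A * μ = 1` almost everywhere and the sets `y - A` converge pointwise to `B` as `y → x`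
within an open set accumulating at `x`, then `μ B = 1`. -/
lemma measure_eq_one_of_eventually_mem_iff {A : Set ℝ} (hA : MeasurableSet A)
    (hb : Bornology.IsBounded A) {μ : Measure ℝ} [IsLocallyFiniteMeasure μ]
    (hμ : ∀ᵐ y ∂(volume : Measure ℝ), μ {t | y - t ∈ A} = 1) {x : ℝ} {s : Set ℝ}
    (hs : IsOpen s) (hx : x ∈ closure s) {B : Set ℝ}
    (hlim : ∀ t, ∀ᶠ y in 𝓝[s] x, y - t ∈ A ↔ t ∈ B) : μ B = 1 := by
  obtain ⟨r, hr⟩ := (Metric.isBounded_iff_subset_closedBall 0).1 hb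
  have hsub : ∀ᶠ y in 𝓝[s] x, {t | y - t ∈ A} ⊆ Metric.closedBall x (r + 1) := by
    filter_upwards [mem_nhdsWithin_of_mem_nhds (Metric.ball_mem_nhds x one_pos)] with y hy t ht
    have h1 := hr ht
    rw [Metric.mem_closedBall, Real.dist_eq, abs_le] at h1 ⊢
    rw [Metric.mem_ball, Real.dist_eq, abs_lt] at hy
    constructor <;> linarith
  have hT : Tendsto (fun y => μ {t | y - t ∈ A}) (𝓝[s] x) (𝓝 (μ B)) :=
    tendsto_measure_of_tendsto_indicator _
      (fun y => (measurable_const.sub measurable_id) hA) Metric.isClosed_closedBall.measurableSet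
      (isCompact_closedBall x (r + 1)).measure_lt_top.ne hsub hlim
  by_contra hne
  obtain ⟨U, hU, hxU, hUs⟩ := mem_nhdsWithin.1 (hT.eventually_ne hne)
  have hnull : volume (U ∩ s) = 0 := measure_mono_null (fun y hy => hUs hy) (ae_iff.1 hμ)
  exact (hU.inter hs).measure_ne_zero volume (mem_closure_iff.1 hx U hU hxU) hnull

lemma eventually_nhdsGT_sub_mem_iff {A : Set ℝ} {l r : ℝ} (h1 : Ioo l r ⊆ A) (h2 : A ⊆ Icc l r)
    (x t : ℝ) : ∀ᶠ y in 𝓝[>] x, y - t ∈ A ↔ x - t ∈ Ico l r := by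
  by_cases hl : l ≤ x - t
  · by_cases hr : x - t < r
    · filter_upwards [Ioo_mem_nhdsGT (show x < r + t by linarith)] with y hy
      exact iff_of_true (h1 ⟨by linarith [hy.1], by linarith [hy.2]⟩) ⟨hl, hr⟩
    · filter_upwards [self_mem_nhdsWithin] with y hy
      have hy : x < y := hy
      exact iff_of_false (fun h => by linarith [(h2 h).2]) (fun h => hr h.2)
  · filter_upwards [Ioo_mem_nhdsGT (show x < l + t by linarith)] with y hy
    exact iff_of_false (fun h => by linarith [(h2 h).1, hy.2]) (fun h => hl h.1)

lemma eventually_nhdsLT_sub_mem_iff {A : Set ℝ} {l r : ℝ} (h1 : Ioo l r ⊆ A) (h2 : A ⊆ Icc l r)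
    (x t : ℝ) : ∀ᶠ y in 𝓝[<] x, y - t ∈ A ↔ x - t ∈ Ioc l r := by
  by_cases hr : x - t ≤ r
  · by_cases hl : l < x - t
    · filter_upwards [Ioo_mem_nhdsLT (show l + t < x by linarith)] with y hy
      exact iff_of_true (h1 ⟨by linarith [hy.1], by linarith [hy.2]⟩) ⟨hl, hr⟩
    · filter_upwards [self_mem_nhdsWithin] with y hy
      have hy : y < x := hy
      exact iff_of_false (fun h => by linarith [(h2 h).1]) (fun h => hl h.1)
  · filter_upwards [Ioo_mem_nhdsLT (show r + t < x by linarith)] with y hy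
    exact iff_of_false (fun h => by linarith [(h2 h).2, hy.1]) (fun h => hr h.2)

/-! ### Measures tiling the line by a short and a long interval -/

/-- The convolution of `μ` with the indicator of the disjoint union of a short interval
`[i, i + a)` and a long interval `[j, j + b)` is `1` at every point, and the same holds for the
half-open intervals containing their right endpoints instead. -/
structure TilesLine (i a j b : ℝ) (μ : Measure ℝ) : Prop where
  pos : 0 < a
  lt : a < b
  separated : i + a ≤ j ∨ j + b ≤ i
  ico : ∀ x, μ {t | x - t ∈ Ico i (i + a) ∪ Ico j (j + b)} = 1
  ioc : ∀ x, μ {t | x - t ∈ Ioc i (i + a) ∪ Ioc j (j + b)} = 1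

namespace TilesLine

variable {i a j b : ℝ} {μ : Measure ℝ}

lemma singleton_le_one (h : TilesLine i a j b μ) (t : ℝ) : μ {t} ≤ 1 := by
  rw [← h.ico (t + i)]
  refine measure_mono ?_
  rintro _ rfl
  exact Or.inl ⟨by linarith, by linarith [h.pos]⟩

/-- Packing: a tile of full mass at `t` leaves no mass for the tiles whose interior meets it. -/
lemma exists_nhds_null (h : TilesLine i a j b μ) {t u x : ℝ} (ht : μ {t} = 1)
    (hxt : x - t ∈ Ico i (i + a) ∪ Ico j (j + b)) (hxu : x - u ∈ Ioo i (i + a) ∪ Ioo j (j + b)) :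
    ∃ s ∈ 𝓝 u, μ (s \ {t}) = 0 := by
  refine ⟨{v | x - v ∈ Ioo i (i + a) ∪ Ioo j (j + b)},
    ((isOpen_Ioo.union isOpen_Ioo).preimage (continuous_const.sub continuous_id)).mem_nhds hxu, ?_⟩
  have h1 : μ ({v | x - v ∈ Ico i (i + a) ∪ Ico j (j + b)} \ {t}) = 0 := by
    rw [measure_sdiff (by rintro _ rfl; exact hxt) (measurableSet_singleton t).nullMeasurableSet
      (by simp [ht]), h.ico, ht, tsub_self]
  exact measure_mono_null
    (sdiff_subset_sdiff_left fun v hv => hv.imp (Ioo_subset_Ico_self ·) (Ioo_subset_Ico_self ·)) h1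

lemma exists_nhds_null_of_sub_mem (h : TilesLine i a j b μ) {t u : ℝ} (ht : μ {t} = 1)
    (htu : t - u ∈ Ioo (i - (j + b)) (i + a - j)) : ∃ s ∈ 𝓝 u, μ (s \ {t}) = 0 := by
  have ha := h.pos
  have hb := h.pos.trans h.lt
  obtain ⟨x, hx1, hx2⟩ : ∃ x, max (t + j) (u + i) < x ∧ x < min (t + (j + b)) (u + (i + a)) := by
    refine exists_between (max_lt (lt_min ?_ ?_) (lt_min ?_ ?_)) <;> linarith [htu.1, htu.2]
  rw [max_lt_iff] at hx1
  rw [lt_min_iff] at hx2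
  exact h.exists_nhds_null (x := x) ht (Or.inr ⟨by linarith, by linarith⟩)
    (Or.inl ⟨by linarith, by linarith⟩)

/-- The translate of the long interval by `t` does not meet the translate of the short one
by `u`. -/
lemma singleton_eq_zero_of_sub_mem (h : TilesLine i a j b μ) {t u : ℝ} (ht : μ {t} = 1)
    (htu : t - u ∈ Ioo (i - (j + b)) (i + a - j)) : μ {u} = 0 := by
  obtain ⟨s, hs, hs0⟩ := h.exists_nhds_null_of_sub_mem ht htu
  refine measure_mono_null ?_ hs0
  rintro _ rfl
  refine ⟨mem_of_mem_nhds hs, ?_⟩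
  rintro rfl
  rw [sub_self] at htu
  have := h.pos
  have := h.lt
  rcases h.separated with h' | h' <;> linarith [htu.1, htu.2]

/-- The translates of the long interval by `t` and `u` do not meet. -/
lemma singleton_eq_zero_of_abs_lt (h : TilesLine i a j b μ) {t u : ℝ} (ht : μ {t} = 1)
    (hne : u ≠ t) (htu : |t - u| < b) : μ {u} = 0 := by
  have hb := h.pos.trans h.lt
  rw [abs_lt] at htu
  obtain ⟨x, hx1, hx2⟩ : ∃ x, max (t + j) (u + j) < x ∧ x < min (t + (j + b)) (u + (j + b)) := by
    refine exists_between (max_lt (lt_min ?_ ?_) (lt_min ?_ ?_)) <;> linarith [htu.1, htu.2]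
  rw [max_lt_iff] at hx1
  rw [lt_min_iff] at hx2
  obtain ⟨s, hs, hs0⟩ := h.exists_nhds_null (x := x) (u := u) ht
    (Or.inr ⟨by linarith, by linarith⟩) (Or.inr ⟨by linarith, by linarith⟩)
  refine measure_mono_null ?_ hs0
  rintro _ rfl
  exact ⟨mem_of_mem_nhds hs, hne⟩

/-- Balance of endpoints: at each point, the mass of the intervals starting there equals the
mass of the intervals ending there. -/
lemma endpoint_balance (h : TilesLine i a j b μ) (x : ℝ) :
    μ {x - i} + μ {x - j} = μ {x - (i + a)} + μ {x - (j + b)} := by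
  have key : ∀ l r : ℝ, l < r → μ {t | x - t ∈ Ico l r} + μ {x - r}
      = μ {t | x - t ∈ Ioc l r} + μ {x - l} := by
    intro l r hlr
    have e1 : {t | x - t ∈ Ico l r} = Ioc (x - r) (x - l) := by
      ext t; constructor <;> rintro ⟨h1, h2⟩ <;> constructor <;> linarith
    have e2 : {t | x - t ∈ Ioc l r} = Ico (x - r) (x - l) := by
      ext t; constructor <;> rintro ⟨h1, h2⟩ <;> constructor <;> linarith
    rw [e1, e2, ← measure_union (by simp) (measurableSet_singleton _),
      ← measure_union (by simp) (measurableSet_singleton _), union_singleton, union_singleton,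
      Ioc_insert_left (by linarith), Ico_insert_right (by linarith)]
  have meas : ∀ s : Set ℝ, MeasurableSet s → MeasurableSet {t | x - t ∈ s} :=
    fun s hs => (measurable_const.sub measurable_id) hs
  have ha := h.pos
  have hb := h.pos.trans h.lt
  have h1 : μ {t | x - t ∈ Ico i (i + a)} + μ {t | x - t ∈ Ico j (j + b)} = 1 := by
    rw [← h.ico x, ← measure_union _ (meas _ measurableSet_Ico)]
    · rfl
    · refine disjoint_left.2 ?_
      rintro t ⟨h1, h2⟩ ⟨h3, h4⟩
      rcases h.separated with h' | h' <;> linarith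
  have h2 : μ {t | x - t ∈ Ioc i (i + a)} + μ {t | x - t ∈ Ioc j (j + b)} = 1 := by
    rw [← h.ioc x, ← measure_union _ (meas _ measurableSet_Ioc)]
    · rfl
    · refine disjoint_left.2 ?_
      rintro t ⟨h1, h2⟩ ⟨h3, h4⟩
      rcases h.separated with h' | h' <;> linarith
  have k1 := key i (i + a) (by linarith)
  have k2 := key j (j + b) (by linarith)
  refine (ENNReal.add_right_inj (ENNReal.one_ne_top)).1 ?_
  calc 1 + (μ {x - i} + μ {x - j})
      = (μ {t | x - t ∈ Ioc i (i + a)} + μ {x - i})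
        + (μ {t | x - t ∈ Ioc j (j + b)} + μ {x - j}) := by rw [← h2]; ring
    _ = 1 + (μ {x - (i + a)} + μ {x - (j + b)}) := by rw [← k1, ← k2, ← h1]; ring

/-- A short interval is immediately followed by a long one. -/
lemma singleton_next_eq_one (h : TilesLine i a j b μ) {t : ℝ} (ht : μ {t} = 1) :
    μ {t + (i + a - j)} = 1 := by
  have ha := h.pos
  have h0 : μ {t + a} = 0 := h.singleton_eq_zero_of_abs_lt ht (by linarith)
    (by rw [show t - (t + a) = -a by ring, abs_neg, abs_of_pos ha]; exact h.lt)
  have := h.endpoint_balance (t + i + a)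
  rw [show t + i + a - i = t + a by ring, show t + i + a - j = t + (i + a - j) by ring,
    show t + i + a - (i + a) = t by ring, h0, ht, zero_add] at this
  exact le_antisymm (h.singleton_le_one _) (this ▸ le_self_add)

/-- A short interval is immediately preceded by a long one. -/
lemma singleton_prev_eq_one (h : TilesLine i a j b μ) {t : ℝ} (ht : μ {t} = 1) :
    μ {t + (i - (j + b))} = 1 := by
  have ha := h.pos
  have h0 : μ {t - a} = 0 := h.singleton_eq_zero_of_abs_lt ht (by linarith)
    (by rw [show t - (t - a) = a by ring, abs_of_pos ha]; exact h.lt)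
  have := h.endpoint_balance (t + i)
  rw [show t + i - i = t by ring, show t + i - (i + a) = t - a by ring,
    show t + i - (j + b) = t + (i - (j + b)) by ring, h0, ht, zero_add] at this
  exact le_antisymm (h.singleton_le_one _) (this ▸ le_self_add)

lemma singleton_nat_mul_sub_eq_one (h : TilesLine i a j b μ) (h0 : μ {0} = 1) (N : ℕ) :
    ∀ m : ℕ, m ≤ N → μ {N * (i + a - j) - m * (a + b)} = 1 := by
  induction N with
  | zero =>
    intro m hm
    obtain rfl : m = 0 := by omega
    simpa using h0
  | succ N ih =>
    rintro (_ | m) hm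
    · convert h.singleton_next_eq_one (ih 0 (by omega)) using 3
      push_cast
      ring
    · convert h.singleton_prev_eq_one (ih m (by omega)) using 3
      push_cast
      ring

/-- The offset from a short interval to the long one following it is a multiple of the period:
otherwise the interval of length `a + b` of forbidden differences would contain a nonzero
multiple of `a + b`, which is a difference of two points of full mass. -/
lemma exists_offset_eq_int_mul (h : TilesLine i a j b μ) (h0 : μ {0} = 1) :
    ∃ k : ℤ, i + a - j = k * (a + b) := by
  have ha := h.pos
  have hb := h.pos.trans h.lt
  have hd : 0 < a + b := by linarith
  set k := ⌈(i + a - j) / (a + b)⌉ with hk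
  refine ⟨k, ?_⟩
  have hle : i + a - j ≤ k * (a + b) := (div_le_iff₀ hd).1 (Int.le_ceil _)
  have hlt : (k - 1 : ℝ) * (a + b) < i + a - j := by
    rw [← lt_div_iff₀ hd]
    linarith [Int.ceil_lt_add_one ((i + a - j) / (a + b))]
  by_contra hne
  have hlt' : i + a - j < k * (a + b) := lt_of_le_of_ne hle hne
  obtain ⟨m, hm | hm⟩ := Int.eq_nat_or_neg (k - 1)
  · have hm' : (k - 1 : ℝ) = m := by exact_mod_cast hm
    have e0 := h.singleton_eq_zero_of_sub_mem (h.singleton_nat_mul_sub_eq_one h0 m 0 (Nat.zero_le _))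
      (u := m * (i + a - j) - m * (a + b))
      (by rw [← hm', Nat.cast_zero]; constructor <;> linarith)
    rw [h.singleton_nat_mul_sub_eq_one h0 m m le_rfl] at e0
    exact one_ne_zero e0
  · have hm' : (k - 1 : ℝ) = -m := by exact_mod_cast hm
    have e0 := h.singleton_eq_zero_of_sub_mem (h.singleton_nat_mul_sub_eq_one h0 m m le_rfl)
      (u := m * (i + a - j) - (0 : ℕ) * (a + b))
      (by
        rw [Nat.cast_zero, show m * (i + a - j) - m * (a + b) - (m * (i + a - j) - 0 * (a + b))
          = -m * (a + b) by ring, ← hm']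
        constructor <;> linarith)
    rw [h.singleton_nat_mul_sub_eq_one h0 m 0 (Nat.zero_le _)] at e0
    exact one_ne_zero e0

/-- The endpoint balance solved for the mass at `y`: the mass at `n (a + b)` is determined by the
masses at farther multiples of `a + b`. -/
lemma singleton_int_mul_eq_one_of_farther (h : TilesLine i a j b μ) {k n : ℤ}
    (hk : i + a - j = k * (a + b))
    (h1 : μ {((n + 2 * k - 1 : ℤ) : ℝ) * (a + b)} = 1)
    (h2 : μ {((n + k : ℤ) : ℝ) * (a + b)} = 1 ∨ μ {((n + k - 1 : ℤ) : ℝ) * (a + b)} = 1) :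
    μ {(n : ℝ) * (a + b)} = 1 := by
  have ha := h.pos
  have hb := h.pos.trans h.lt
  push_cast at h1 h2
  refine le_antisymm (h.singleton_le_one _) ?_
  rcases h2 with h2 | h2
  · have e := h.endpoint_balance (n * (a + b) + i + a)
    have z : μ {n * (a + b) + i + a - (j + b)} = 0 :=
      h.singleton_eq_zero_of_sub_mem h1 (by constructor <;> linarith)
    rw [z, show n * (a + b) + i + a - j = (n + k) * (a + b) by linarith, h2,
      show n * (a + b) + i + a - (i + a) = n * (a + b) by ring, add_zero] at e
    exact e ▸ le_add_self
  · have e := h.endpoint_balance (n * (a + b) + i)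
    have z : μ {n * (a + b) + i - j} = 0 :=
      h.singleton_eq_zero_of_sub_mem h1 (by constructor <;> linarith)
    rw [z, show n * (a + b) + i - (j + b) = (n + k - 1) * (a + b) by linarith, h2,
      show n * (a + b) + i - i = n * (a + b) by ring, add_zero] at e
    exact e ▸ le_add_self

end TilesLine

/-- A predicate on `ℤ` that is closed under subtracting `K` and `K + 1` holds at all sufficiently
negative integers if it holds at `0`; a backward recurrence then propagates it upwards. -/
lemma forall_int_of_recurrence {P : ℤ → Prop} {K : ℤ} (hK : 0 ≤ K) (h0 : P 0)
    (h1 : ∀ n, P n → P (n - K)) (h2 : ∀ n, P n → P (n - (K + 1)))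
    (h3 : ∀ n, P (n - (2 * K + 1)) → P (n - (K + 1)) → P n) (n : ℤ) : P n := by
  lift K to ℕ using hK
  have hsg : ∀ r s : ℕ, P (-(r * K + s * (K + 1))) := by
    intro r s
    induction r with
    | zero =>
      induction s with
      | zero => simpa using h0
      | succ s ih => convert h2 _ ih using 1; push_cast; ring
    | succ r ih => convert h1 _ ih using 1; push_cast; ring
  have hfar : ∀ m : ℕ, K * K ≤ m → P (-m) := by
    intro m hm
    rcases Nat.eq_zero_or_pos K with rfl | hpos
    · simpa using hsg 0 m
    -- Division with remainder, `m = K q + r` with `r < K ≤ q`, is `m = (q - r) K + r (K + 1)`.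
    · have hq : m % K ≤ m / K :=
        (Nat.mod_lt m hpos).le.trans ((Nat.le_div_iff_mul_le hpos).2 hm)
      convert hsg (m / K - m % K) (m % K) using 2
      have e := Nat.div_add_mod m K
      zify [hq] at e ⊢
      linarith
  have hup : ∀ N : ℕ, ∀ m : ℤ, m ≤ -(K * K) + N → P m := by
    intro N
    induction N with
    | zero =>
      intro m hm
      have hKK : (0 : ℤ) ≤ K * K := by positivity
      obtain ⟨l, rfl⟩ : ∃ l : ℕ, m = -l := ⟨m.natAbs, by push_cast at hm; omega⟩
      exact hfar l (by zify; push_cast at hm; linarith)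
    | succ N ih =>
      intro m hm
      push_cast at hm
      exact h3 m (ih _ (by linarith)) (ih _ (by linarith))
  refine hup (n + K * K).natAbs n ?_
  have := Int.le_natAbs (a := n + K * K)
  linarith

namespace TilesLine

variable {i a j b : ℝ} {μ : Measure ℝ}

lemma singleton_int_mul_eq_one (h : TilesLine i a j b μ) (h0 : μ {0} = 1) {k : ℤ}
    (hk : i + a - j = k * (a + b)) (n : ℤ) : μ {(n : ℝ) * (a + b)} = 1 := by
  have ha := h.pos
  have hb := h.pos.trans h.lt
  have hd : 0 < a + b := by linarith
  have hp : ∀ n : ℤ, μ {(n : ℝ) * (a + b)} = 1 → μ {((n + k : ℤ) : ℝ) * (a + b)} = 1 := by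
    intro n hn
    convert h.singleton_next_eq_one hn using 3
    push_cast
    linarith
  have hq : ∀ n : ℤ, μ {(n : ℝ) * (a + b)} = 1 → μ {((n + k - 1 : ℤ) : ℝ) * (a + b)} = 1 := by
    intro n hn
    convert h.singleton_prev_eq_one hn using 3
    push_cast
    linarith
  have hback := fun n => h.singleton_int_mul_eq_one_of_farther (n := n) hk
  -- Full masses spread to the left if the short interval is the left one, else to the right.
  rcases h.separated with hs | hs
  · have hk0 : k ≤ 0 := by
      have : (k : ℝ) ≤ 0 := by by_contra! hc; nlinarith
      exact_mod_cast this
    refine forall_int_of_recurrence (P := fun n : ℤ => μ {(n : ℝ) * (a + b)} = 1) (K := -k)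
      (by omega) (by simpa using h0) ?_ ?_ ?_ n
    · intro n hn
      convert hp n hn using 5
      ring
    · intro n hn
      convert hq n hn using 5
      ring
    · intro n h1 h2
      refine hback n ?_ (Or.inr ?_)
      · convert h1 using 5
        ring
      · convert h2 using 5
        ring
  · have hk1 : 1 ≤ k := by
      have : (1 : ℝ) ≤ k := by by_contra! hc; nlinarith
      exact_mod_cast this
    have := forall_int_of_recurrence (P := fun n : ℤ => μ {((-n : ℤ) : ℝ) * (a + b)} = 1)
      (K := k - 1) (by omega) (by simpa using h0) ?_ ?_ ?_ (-n)
    · simpa using this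
    · intro n hn
      convert hq _ hn using 5
      ring
    · intro n hn
      convert hp _ hn using 5
      ring
    · intro n h1 h2
      refine hback _ ?_ (Or.inl ?_)
      · convert h1 using 5
        ring
      · convert h2 using 5
        ring

lemma measure_compl_range_eq_zero (h : TilesLine i a j b μ) (h0 : μ {0} = 1) {k : ℤ}
    (hk : i + a - j = k * (a + b)) : μ (range fun n : ℤ => (n : ℝ) * (a + b))ᶜ = 0 := by
  have hd : 0 < a + b := by linarith [h.pos, h.lt]
  refine measure_null_of_locally_null _ fun u hu => ?_
  -- If `u` lies strictly between `m (a + b)` and `(m + 1)(a + b)`, the short interval of the tile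
  -- at `u` meets the long interval of the tile at `(m + k)(a + b)`.
  set m := ⌊u / (a + b)⌋ with hm
  have h1 : m * (a + b) ≤ u := (le_div_iff₀ hd).1 (Int.floor_le _)
  have h2 : u < (m + 1) * (a + b) := (div_lt_iff₀ hd).1 (Int.lt_floor_add_one _)
  have h3 : m * (a + b) ≠ u := fun he => hu ⟨m, he⟩
  have h4 : m * (a + b) < u := lt_of_le_of_ne h1 h3
  obtain ⟨s, hs, hs0⟩ := h.exists_nhds_null_of_sub_mem (u := u)
    (h.singleton_int_mul_eq_one h0 hk (m + k)) (by push_cast; constructor <;> linarith)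
  refine ⟨s ∩ (range fun n : ℤ => (n : ℝ) * (a + b))ᶜ,
    inter_mem (mem_nhdsWithin_of_mem_nhds hs) self_mem_nhdsWithin, measure_mono_null ?_ hs0⟩
  rintro v ⟨hv, hv'⟩
  refine ⟨hv, ?_⟩
  rintro rfl
  exact hv' ⟨m + k, rfl⟩

end TilesLine

/-! ### From weak tilings to lattice tilings -/

lemma IsInterval.sInf_lt_sSup {I : Set ℝ} (h : IsInterval I) : sInf I < sSup I := by
  obtain ⟨x, hx⟩ := h.nondegenerate
  obtain ⟨l, u, hlu, hsub⟩ := mem_nhds_iff_exists_Ioo_subset.1 (mem_interior_iff_mem_nhds.1 hx)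
  obtain ⟨y, hy1, hy2⟩ := exists_between hlu.2
  have h1 : sInf I ≤ x := csInf_le h.bounded.bddBelow (hsub hlu)
  have h2 : y ≤ sSup I := le_csSup h.bounded.bddAbove (hsub ⟨hlu.1.trans hy1, hy2⟩)
  linarith

lemma IsInterval.Ioo_subset {I : Set ℝ} (h : IsInterval I) : Ioo (sInf I) (sSup I) ⊆ I :=
  IsConnected.Ioo_csInf_csSup_subset
    ⟨h.nondegenerate.mono interior_subset, isPreconnected_iff_ordConnected.2 h.ordConnected⟩
    h.bounded.bddBelow h.bounded.bddAbove

lemma IsInterval.subset_Icc {I : Set ℝ} (h : IsInterval I) : I ⊆ Icc (sInf I) (sSup I) :=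
  subset_Icc_csInf_csSup h.bounded.bddBelow h.bounded.bddAbove

lemma IsInterval.volume_eq {I : Set ℝ} (h : IsInterval I) :
    volume I = ENNReal.ofReal (sSup I - sInf I) :=
  le_antisymm (by simpa using measure_mono (μ := volume) h.subset_Icc)
    (by simpa using measure_mono (μ := volume) h.Ioo_subset)

/-- Adding the tile at `0` to a weak tiling of the complement gives a tiling of the line. -/
lemma IsWeakTilingMeasure.ae_add_dirac_eq_one {A : Set ℝ} (hA : MeasurableSet A) {ν : Measure ℝ}
    (hν : IsWeakTilingMeasure A ν) :
    ∀ᵐ y ∂(volume : Measure ℝ), (ν + Measure.dirac 0 : Measure ℝ) {t | y - t ∈ A} = 1 := by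
  filter_upwards [hν.conv_eq] with y hy
  rw [indicatorConv_eq_measure hA] at hy
  have hm : MeasurableSet {t : ℝ | y - t ∈ A} := (measurable_const.sub measurable_id) hA
  rw [Measure.add_apply, hy, Measure.dirac_apply' _ hm]
  by_cases hyA : y ∈ A <;> simp [hyA, indicator]

lemma IsWeakTilingMeasure.tilesLine {S L : Set ℝ} (hS : IsInterval S) (hL : IsInterval L)
    (hdisj : Disjoint S L) (hlen : volume S < volume L) {ν : Measure ℝ}
    (hν : IsWeakTilingMeasure (S ∪ L) ν) :
    TilesLine (sInf S) (sSup S - sInf S) (sInf L) (sSup L - sInf L) (ν + Measure.dirac 0) := by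
  have hA : MeasurableSet (S ∪ L) :=
    hS.ordConnected.measurableSet.union hL.ordConnected.measurableSet
  have hlf : IsLocallyFiniteMeasure (ν + Measure.dirac 0) := ⟨fun x => by
    have := hν.locallyFinite
    obtain ⟨s, hs, hs'⟩ := ν.finiteAt_nhds x
    exact ⟨s, hs, by
      rw [Measure.add_apply]; exact ENNReal.add_lt_top.2 ⟨hs', measure_lt_top _ s⟩⟩⟩
  have hae := hν.ae_add_dirac_eq_one hA
  have hb := hS.bounded.union hL.bounded
  have h1 := hS.sInf_lt_sSup
  have h2 := hL.sInf_lt_sSup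
  refine ⟨by linarith, ?_, ?_, fun x => ?_, fun x => ?_⟩
  · rw [hS.volume_eq, hL.volume_eq] at hlen
    exact lt_of_not_ge fun hc => hlen.not_ge (ENNReal.ofReal_le_ofReal hc)
  · have := Ioo_disjoint_Ioo.1 (hdisj.mono hS.Ioo_subset hL.Ioo_subset)
    rw [min_le_iff, le_max_iff, le_max_iff] at this
    rcases this with (h | h) | (h | h)
    · linarith
    · left; linarith
    · right; linarith
    · linarith
  · rw [add_sub_cancel, add_sub_cancel]
    refine measure_eq_one_of_eventually_mem_iff hA hb hae isOpen_Ioi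
      (by rw [closure_Ioi]; exact self_mem_Ici) (x := x) fun t => ?_
    filter_upwards [eventually_nhdsGT_sub_mem_iff hS.Ioo_subset hS.subset_Icc x t,
      eventually_nhdsGT_sub_mem_iff hL.Ioo_subset hL.subset_Icc x t] with y e1 e2
    exact or_congr e1 e2
  · rw [add_sub_cancel, add_sub_cancel]
    refine measure_eq_one_of_eventually_mem_iff hA hb hae isOpen_Iio
      (by rw [closure_Iio]; exact self_mem_Iic) (x := x) fun t => ?_
    filter_upwards [eventually_nhdsLT_sub_mem_iff hS.Ioo_subset hS.subset_Icc x t,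
      eventually_nhdsLT_sub_mem_iff hL.Ioo_subset hL.subset_Icc x t] with y e1 e2
    exact or_congr e1 e2

lemma eq_sum_dirac_of_singleton_eq_one {ν : Measure ℝ} {T : Set ℝ} (hT : T.Countable)
    (h0 : ν Tᶜ = 0) (h1 : ∀ t ∈ T, ν {t} = 1) :
    ν = Measure.sum (fun t : T => Measure.dirac (t : ℝ)) := by
  ext s hs
  have e1 : ν s = ν (⋃ t ∈ T, s ∩ {t}) := by
    rw [← inter_iUnion₂, biUnion_of_singleton, measure_inter_conull h0]
  rw [e1, measure_biUnion hT (fun x _ y _ hxy => by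
      refine disjoint_left.2 ?_
      rintro z ⟨-, rfl⟩ ⟨-, rfl⟩
      exact hxy rfl) (fun t _ => hs.inter (measurableSet_singleton t)),
    Measure.sum_apply _ hs]
  congr 1 with ⟨t, ht⟩
  rw [Measure.dirac_apply' _ hs]
  by_cases hts : t ∈ s
  · rw [inter_eq_self_of_subset_right (by simpa using hts), h1 t ht]
    simp [hts]
  · rw [inter_singleton_eq_empty.2 hts]
    simp [hts]

lemma mem_translate {A : Set ℝ} {t x : ℝ} : x ∈ translate A t ↔ x - t ∈ A := by
  simp [translate, sub_eq_add_neg]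

/-- A weak tiling measure with atoms of mass one is a proper tiling. -/
lemma IsWeakTilingMeasure.isProperTiling {A : Set ℝ} (hA : MeasurableSet A) {ν : Measure ℝ}
    (hν : IsWeakTilingMeasure A ν) {T : Set ℝ} (hT : T.Countable) (h0 : ν Tᶜ = 0)
    (h1 : ∀ t ∈ T, ν {t} = 1) : IsProperTiling A T Aᶜ := by
  have hae : ∀ᵐ x ∂(volume : Measure ℝ),
      ν {t | x - t ∈ A} = Aᶜ.indicator (fun _ => (1 : ℝ≥0∞)) x := by
    simpa only [indicatorConv_eq_measure hA] using hν.conv_eq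
  have hle : ∀ᵐ x ∂(volume : Measure ℝ), ν {t | x - t ∈ A} ≤ 1 := by
    filter_upwards [hae] with x hx
    rw [hx]
    exact indicator_le_self' (fun _ _ => zero_le) x
  refine ⟨hT, fun s hs t ht hst => ?_, ?_⟩
  · refine measure_mono_null (fun x hx => ?_) (ae_iff.1 hle)
    have hsub : {s} ∪ {t} ⊆ {t | x - t ∈ A} := by
      rintro _ (rfl | rfl)
      exacts [mem_translate.1 hx.1, mem_translate.1 hx.2]
    have h2 := measure_mono (μ := ν) hsub
    rw [measure_union (by simpa using hst) (measurableSet_singleton t), h1 s hs, h1 t ht,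
      one_add_one_eq_two] at h2
    exact fun hc => absurd (h2.trans hc) (by simp)
  · refine Filter.eventuallyEq_set.2 ?_
    filter_upwards [hae] with x hx
    simp only [mem_iUnion, mem_translate, exists_prop]
    constructor
    · rintro ⟨t, ht, hxt⟩
      by_contra hxA
      rw [indicator_of_notMem hxA] at hx
      have := measure_mono_null (s := {t}) (singleton_subset_iff.2 hxt) hx
      rw [h1 t ht] at this
      exact one_ne_zero this
    · intro hxA
      rw [indicator_of_mem hxA] at hx
      by_contra! hc
      have hsub : {t | x - t ∈ A} ⊆ Tᶜ := fun t ht hT' => hc t hT' ht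
      rw [measure_mono_null hsub h0] at hx
      exact zero_ne_one hx

lemma Alternating.symm {I J T : Set ℝ} (h : Alternating I J T) : Alternating J I T :=
  fun t ht => ⟨(h t ht).2.2.1, (h t ht).2.2.2, (h t ht).1, (h t ht).2.1⟩

lemma IsWeakTilingMeasure.exists_alternating {S L : Set ℝ} (hS : IsInterval S)
    (hL : IsInterval L) (hdisj : Disjoint S L) (hlen : volume S < volume L) {ν : Measure ℝ}
    (hν : IsWeakTilingMeasure (S ∪ L) ν) :
    ∃ T : Set ℝ, ν = Measure.sum (fun t : T => Measure.dirac (t : ℝ)) ∧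
      IsProperTiling (S ∪ L) T (S ∪ L)ᶜ ∧ Alternating S L (insert 0 T) := by
  have h := hν.tilesLine hS hL hdisj hlen
  have hA : MeasurableSet (S ∪ L) :=
    hS.ordConnected.measurableSet.union hL.ordConnected.measurableSet
  have hd0 : (Measure.dirac (0 : ℝ)) {0} = 1 := by simp
  have hμ0 : (ν + Measure.dirac 0 : Measure ℝ) {0} = 1 :=
    le_antisymm (h.singleton_le_one 0) (by rw [Measure.add_apply, hd0]; exact le_add_self)
  have hν0 : ν {0} = 0 := by
    rw [Measure.add_apply, hd0] at hμ0
    exact (ENNReal.add_left_inj ENNReal.one_ne_top).1 (by rw [hμ0, zero_add])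
  obtain ⟨k, hk⟩ := h.exists_offset_eq_int_mul hμ0
  have hone := h.singleton_int_mul_eq_one hμ0 hk
  have hnull := h.measure_compl_range_eq_zero hμ0 hk
  set d := sSup S - sInf S + (sSup L - sInf L) with hd
  set Λ : Set ℝ := range fun n : ℤ => (n : ℝ) * d with hΛ
  have hcount : (Λ \ {0}).Countable := (countable_range _).mono sdiff_subset
  have hTc : ν (Λ \ {0})ᶜ = 0 := by
    refine measure_mono_null (t := Λᶜ ∪ {0}) ?_ (measure_union_null ?_ hν0)
    · intro x hx
      by_cases hx0 : x = 0
      · exact Or.inr hx0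
      · exact Or.inl fun hxΛ => hx ⟨hxΛ, hx0⟩
    · exact le_antisymm (hnull ▸ (by rw [Measure.add_apply]; exact le_self_add)) zero_le
  have hT1 : ∀ t ∈ Λ \ {0}, ν {t} = 1 := by
    rintro _ ⟨⟨n, rfl⟩, hn⟩
    have e := hone n
    have hn' : (0 : ℝ) ∉ ({(n : ℝ) * d} : Set ℝ) := fun h0 => hn h0.symm
    rwa [Measure.add_apply, Measure.dirac_apply' _ (measurableSet_singleton _),
      indicator_of_notMem hn', add_zero] at e
  refine ⟨Λ \ {0}, eq_sum_dirac_of_singleton_eq_one hcount hTc hT1,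
    hν.isProperTiling hA hcount hTc hT1, ?_⟩
  rw [insert_sdiff_singleton, insert_eq_of_mem (show (0 : ℝ) ∈ Λ from ⟨0, by simp⟩)]
  rintro _ ⟨n, rfl⟩
  refine ⟨⟨_, ⟨n + k, rfl⟩, ?_⟩, ⟨_, ⟨n + k - 1, rfl⟩, ?_⟩, ⟨_, ⟨n - k + 1, rfl⟩, ?_⟩,
    ⟨_, ⟨n - k, rfl⟩, ?_⟩⟩ <;> push_cast <;> linarith

end WeakTiling

theorem theorem3p10 (I J : Set ℝ) (hI : WeakTiling.IsInterval I) (hJ : WeakTiling.IsInterval J)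
    (hdisj : Disjoint I J) (hlen : volume I ≠ volume J)
    (ν : Measure ℝ) (hν : WeakTiling.IsWeakTilingMeasure (I ∪ J) ν) :
    ∃ T : Set ℝ,
      ν = Measure.sum (fun t : T => Measure.dirac (t : ℝ)) ∧
      WeakTiling.IsProperTiling (I ∪ J) T (I ∪ J)ᶜ ∧
      WeakTiling.Alternating I J (insert 0 T) := by
  rcases lt_or_gt_of_ne hlen with h | h
  · exact hν.exists_alternating hI hJ hdisj h
  · rw [union_comm] at hν ⊢
    obtain ⟨T, h1, h2, h3⟩ := hν.exists_alternating hJ hI hdisj.symm h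
    exact ⟨T, h1, h2, h3.symm⟩
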